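/- Let $I$ be a finite set and let $X=(X_i)_{i\in I}$ be a simple max-stable random vector on a probability space $(\Omega,\mathcal A,\mathbb P)$, i.e. each $X_i$ is standard Fréchet distributed, $\mathbb P(X_i\le t)=e^{-1/t}$ for $t>0$, and for every $n\ge 1$ the componentwise maximum of $n$ independent copies of $X$ has the same distribution as $nX$. Assume that the joint distribution of $X$ has a density with respect to Lebesgue measure which is positive and continuous on $(0,\infty)^I$ and vanishes elsewhere. For $A\subset I$ and $x\in(0,\infty)^I$ write $X_A=(X_i)_{i\in A}$, $x_A=(x_i)_{i\in A}$, and let $$V^A(x_A)=-\log \mathbb P(X_i\le x_i,\ i\in A),\qquad V=V^I,\qquad V^{\emptyset}=0.$$ For non-empty disjoint $A,B\subset I$ and $C=I\setminus(A\cup B)$ (possibly empty) put, for $x\in(0,\infty)^I$, $$d_{A,B}(x)=V^{A\cup C}(x_{A\cup C})+V^{B\cup C}(x_{B\cup C})-V(x)-V^{C}(x_C),$$ $$\chi_{A,B}(x_{A\cup B})=V^{A}(x_A)+V^{B}(x_B)-V^{A\cup B}(x_{A\cup B}).$$ Then: (a) if $X_A$ and $X_B$ are conditionally independent given (the $\sigma$-algebra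 generated by) $X_C$, then $d_{A,B}(x)=0$ for all $x\in(0,\infty)^I$; (b) $X_A$ and $X_B$ are independent if and only if $\chi_{A,B}(x_{A\cup B})=0$ for all $x\in(0,\infty)^I$. -/

import Mathlib

open MeasureTheory ProbabilityTheory

namespace MaxStable

/-- The open positive orthant `(0,∞)^I`. -/
def posOrthant (I : Type*) : Set (I → ℝ) := {x | ∀ i, 0 < x i}

section Vectors

variable {Ω I : Type*} [MeasurableSpace Ω]

/-- The subvector `X_A = (X_i)_{i ∈ A}` of a random vector `X = (X_i)_{i ∈ I}`. -/
def subvector (X : Ω → I → ℝ) (A : Finset I) : Ω → (A → ℝ) := fun ω i => X ω i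

/-- `X` is simple max-stable: its components are standard Fréchet distributed, and for every
`n ≥ 1` the componentwise maximum of `n` independent copies of `X` has the distribution of `n X`
(the joint law of the `n` independent copies is the `n`-fold product of the law of `X`). -/
structure IsSimpleMaxStable [Fintype I] (P : Measure Ω) (X : Ω → I → ℝ) : Prop where
  frechet : ∀ i : I, ∀ t : ℝ, 0 < t → P.real {ω | X ω i ≤ t} = Real.exp (-1 / t)
  maxStable : ∀ n : ℕ, 0 < n →
    (Measure.pi (fun _ : Fin n => P.map X)).map (fun y i => ⨆ k : Fin n, y k i)
      = P.map (fun ω i => (n : ℝ) * X ω i)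

/-- The joint distribution of the components of `X` has a density (with respect to Lebesgue
measure) that is positive and continuous on `(0,∞)^I` (and vanishes elsewhere). -/
def HasPositiveContinuousDensity [Fintype I] (P : Measure Ω) (X : Ω → I → ℝ) : Prop :=
  ∃ f : (I → ℝ) → ℝ, ContinuousOn f (posOrthant I) ∧ (∀ x ∈ posOrthant I, 0 < f x) ∧
    P.map X = (volume.restrict (posOrthant I)).withDensity (fun x => ENNReal.ofReal (f x))

/-- The marginal distribution function `G^A(x_A) = P(X_i ≤ x_i, i ∈ A)`; it depends on `x` only
through `x_A`, and `G^∅ = 1` for a probability measure `P`. -/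
noncomputable def marginalCDF (P : Measure Ω) (X : Ω → I → ℝ) (A : Finset I) (x : I → ℝ) : ℝ :=
  P.real {ω | ∀ i ∈ A, X ω i ≤ x i}

/-- The exponent function `V^A(x_A) = -log G^A(x_A)`; in particular `V^∅ = 0`. -/
noncomputable def exponentFun (P : Measure Ω) (X : Ω → I → ℝ) (A : Finset I) (x : I → ℝ) : ℝ :=
  -Real.log (marginalCDF P X A x)

/-- `d_{A,B} = V^{A ∪ C} + V^{B ∪ C} - V - V^C` with `C = I ∖ (A ∪ B)` and `V = V^I`. -/
noncomputable def dPair [Fintype I] [DecidableEq I] (P : Measure Ω) (X : Ω → I → ℝ)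
    (A B : Finset I) (x : I → ℝ) : ℝ :=
  exponentFun P X (A ∪ (A ∪ B)ᶜ) x + exponentFun P X (B ∪ (A ∪ B)ᶜ) x
    - exponentFun P X Finset.univ x - exponentFun P X (A ∪ B)ᶜ x

/-- `χ_{A,B} = V^A + V^B - V^{A ∪ B}`. -/
noncomputable def chiPair [DecidableEq I] (P : Measure Ω) (X : Ω → I → ℝ)
    (A B : Finset I) (x : I → ℝ) : ℝ :=
  exponentFun P X A x + exponentFun P X B x - exponentFun P X (A ∪ B) x

/-- `Y₁` and `Y₂` are conditionally independent given `Z`: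
`P(Y₁ ∈ S, Y₂ ∈ T ∣ σ(Z)) = P(Y₁ ∈ S ∣ σ(Z)) P(Y₂ ∈ T ∣ σ(Z))` almost surely, for all measurable
`S` and `T`. Unlike Mathlib's `CondIndepFun`, the probability space need not be standard Borel. -/
def CondIndepGiven {β₁ β₂ γ : Type*} [MeasurableSpace β₁] [MeasurableSpace β₂]
    [mγ : MeasurableSpace γ] (P : Measure Ω) (Y₁ : Ω → β₁) (Y₂ : Ω → β₂) (Z : Ω → γ) : Prop :=
  ∀ (S : Set β₁) (T : Set β₂), MeasurableSet S → MeasurableSet T →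
    P[(Y₁ ⁻¹' S ∩ Y₂ ⁻¹' T).indicator (fun _ => (1 : ℝ)) | mγ.comap Z] =ᵐ[P]
      P[(Y₁ ⁻¹' S).indicator (fun _ => (1 : ℝ)) | mγ.comap Z] *
        P[(Y₂ ⁻¹' T).indicator (fun _ => (1 : ℝ)) | mγ.comap Z]

end Vectors

end MaxStable

/-! Write `μ` for the law of `X` and `G_T` for the distribution function of its marginal on `T`.
Part (a) amounts to `G_{A∪B∪C} G_C = G_{A∪C} G_{B∪C}`. The proof differentiates neither `V` nor the
distribution functions: it reads the `G_T` off as exponential growth rates of conditional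
probabilities at the small scale `1/n`.

By max-stability, the `μ`-probability that `nX` is at most `x` on `T` and within `r` of `x` on `C ⊆
T` is the same probability for the maximum of `n` independent copies. Up to factors polynomial in
`n`, it has size `r^#C G_T^n`, with `G_T` taken at `x` raised by `r` on `C`. For the lower bound,
one copy approximates `x` on `C` and the others only stay below. For the upper bound, at most `#C`
copies realise the maxima on `C`, and there are polynomially many ways to choose them
(`IsMaxStableLaw.exists_sandwich`).

Take `T = S ∪ C` and divide by the case `S = ∅`. As `r → 0` the powers of `r` cancel, and the ratio
tends to the conditional probability of `X_S ≤ t_S / n` given `X_C = y_C / n`. Conditional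
independence makes these limits multiply for every `n`; taking `n`-th roots removes the polynomial
factors (`mul_eq_mul_of_polySandwich`). The identity then holds for almost every `y`, hence
everywhere by continuity.

Part (b) is the factorisation criterion for distribution functions, after taking logarithms. -/

namespace MaxStable

open Filter Topology Set

/-! ### Componentwise maxima of independent copies in a slab -/

section Slab

variable {I : Type*}

/-- The vectors bounded above by `b` on `T` and bounded below by `a` on `J`. -/
def slab (T J : Finset I) (a b : I → ℝ) : Set (I → ℝ) :=
  {y | (∀ i ∈ T, y i ≤ b i) ∧ ∀ i ∈ J, a i ≤ y i}

lemma measurableSet_slab (T J : Finset I) (a b : I → ℝ) : MeasurableSet (slab T J a b) := by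
  have h : slab T J a b = (⋂ i ∈ T, {y : I → ℝ | y i ≤ b i}) ∩ ⋂ i ∈ J, {y | a i ≤ y i} := by
    ext y; simp [slab]
  rw [h]
  refine MeasurableSet.inter (Finset.measurableSet_biInter _ fun i _ => ?_)
    (Finset.measurableSet_biInter _ fun i _ => ?_)
  · exact measurableSet_le (measurable_pi_apply i) measurable_const
  · exact measurableSet_le measurable_const (measurable_pi_apply i)

/-- For each coordinate choose a copy `σ i` attaining the maximum. Copy `k` then inherits the lower
bounds exactly on the fibre of `σ` over `k` in `C`. A union bound over `σ` and independence finish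
the proof. -/
lemma iSup_mem_slab_le [Fintype I] [DecidableEq I] (μ : Measure (I → ℝ)) [IsProbabilityMeasure μ]
    (T C : Finset I) (a b : I → ℝ) (m : ℕ) :
    (Measure.pi fun _ : Fin (m + 1) => μ).real {y | (fun i => ⨆ k, y k i) ∈ slab T C a b} ≤
      ∑ σ : I → Fin (m + 1), ∏ k, μ.real (slab T (C.filter (σ · = k)) a b) := by
  have hsub : {y : Fin (m + 1) → I → ℝ | (fun i => ⨆ k, y k i) ∈ slab T C a b} ⊆
      ⋃ σ : I → Fin (m + 1), univ.pi fun k => slab T (C.filter (σ · = k)) a b := by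
    intro y hy
    have hmax : ∀ i, ∃ k, y k i = ⨆ k, y k i := fun i => exists_eq_ciSup_of_finite
    choose σ hσ using hmax
    simp only [mem_iUnion, Set.mem_pi, mem_univ, forall_true_left]
    refine ⟨σ, fun k => ⟨fun i hi => ?_, fun i hi => ?_⟩⟩
    · exact (le_ciSup (f := fun k => y k i) (finite_range _).bddAbove k).trans (hy.1 i hi)
    · simp only [Finset.mem_filter] at hi
      rw [← hi.2, hσ]
      exact hy.2 i hi.1
  refine (measureReal_mono hsub).trans ((measureReal_iUnion_fintype_le _).trans ?_)
  refine Finset.sum_le_sum fun σ _ => ?_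
  simp [measureReal_def, Measure.pi_pi, ENNReal.toReal_prod]

/-- It suffices that copy `0` meets all the bounds and that the remaining `m` copies meet the upper
ones. -/
lemma le_iSup_mem_slab (μ : Measure (I → ℝ)) [IsProbabilityMeasure μ]
    (T C : Finset I) (a b : I → ℝ) (m : ℕ) :
    μ.real (slab T C a b) * μ.real (slab T ∅ a b) ^ m ≤
      (Measure.pi fun _ : Fin (m + 1) => μ).real {y | (fun i => ⨆ k, y k i) ∈ slab T C a b} := by
  have hsub : (univ.pi fun k : Fin (m + 1) => if k = 0 then slab T C a b else slab T ∅ a b) ⊆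
      {y : Fin (m + 1) → I → ℝ | (fun i => ⨆ k, y k i) ∈ slab T C a b} := by
    intro y hy
    simp only [Set.mem_pi, mem_univ, forall_true_left] at hy
    have h0 : y 0 ∈ slab T C a b := by simpa using hy 0
    refine ⟨fun i hi => ciSup_le fun k => ?_, fun i hi => ?_⟩
    · by_cases hk : k = 0
      · subst hk; exact h0.1 i hi
      · have := hy k
        rw [if_neg hk] at this
        exact this.1 i hi
    · exact (h0.2 i hi).trans (le_ciSup (f := fun k => y k i) (finite_range _).bddAbove 0)
  refine le_trans (le_of_eq ?_) (measureReal_mono hsub)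
  rw [measureReal_def (μ := Measure.pi _), Measure.pi_pi, ENNReal.toReal_prod, Fin.prod_univ_succ]
  simp [measureReal_def, Fin.succ_ne_zero]

end Slab

/-! ### Mass of small boxes and cubes -/

section Density

variable {I : Type*} [Fintype I]

/-- The measure on `ℝ^I` has a density that is positive and continuous on `(0,∞)^I` and vanishes
elsewhere. -/
def IsPositiveDensityLaw (μ : Measure (I → ℝ)) : Prop :=
  ∃ f : (I → ℝ) → ℝ, ContinuousOn f (posOrthant I) ∧ (∀ x ∈ posOrthant I, 0 < f x) ∧
    μ = (volume.restrict (posOrthant I)).withDensity (fun x => ENNReal.ofReal (f x))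

lemma isOpen_posOrthant : IsOpen (posOrthant I) := by
  have : posOrthant I = univ.pi fun _ => Ioi 0 := by ext; simp [posOrthant]
  rw [this]
  exact isOpen_set_pi finite_univ fun _ _ => isOpen_Ioi

lemma IsPositiveDensityLaw.absolutelyContinuous {μ : Measure (I → ℝ)}
    (h : IsPositiveDensityLaw μ) : μ ≪ volume.restrict (posOrthant I) := by
  obtain ⟨f, -, -, rfl⟩ := h
  exact withDensity_absolutelyContinuous _ _

lemma IsPositiveDensityLaw.restrict_absolutelyContinuous {μ : Measure (I → ℝ)}
    (h : IsPositiveDensityLaw μ) : volume.restrict (posOrthant I) ≪ μ := by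
  obtain ⟨f, hc, hf, rfl⟩ := h
  refine withDensity_absolutelyContinuous' ?_ ?_
  · exact (hc.aemeasurable isOpen_posOrthant.measurableSet).ennreal_ofReal
  · filter_upwards [ae_restrict_mem isOpen_posOrthant.measurableSet] with x hx
    simpa using hf x hx

/-- The law charges boxes in the orthant at least proportionally to their volume, locally
uniformly. -/
lemma IsPositiveDensityLaw.exists_le_measure_Icc {μ : Measure (I → ℝ)}
    (h : IsPositiveDensityLaw μ) (a b : I → ℝ) (ha : a ∈ posOrthant I) :
    ∃ δ : ℝ, 0 < δ ∧ ∀ s ⊆ Icc a b, MeasurableSet s →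
      ENNReal.ofReal δ * volume s ≤ μ s := by
  obtain ⟨f, hc, hf, rfl⟩ := h
  have hsub : Icc a b ⊆ posOrthant I := fun y hy i => (ha i).trans_le (hy.1 i)
  obtain ⟨δ, hδ, hle⟩ : ∃ δ : ℝ, 0 < δ ∧ ∀ y ∈ Icc a b, δ ≤ f y := by
    rcases (Icc a b).eq_empty_or_nonempty with he | hne
    · exact ⟨1, one_pos, by simp [he]⟩
    · obtain ⟨y, hy, hmin⟩ := isCompact_Icc.exists_isMinOn hne (hc.mono hsub)
      exact ⟨f y, hf y (hsub hy), fun z hz => hmin hz⟩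
  refine ⟨δ, hδ, fun s hs hsm => ?_⟩
  rw [withDensity_apply _ hsm, Measure.restrict_restrict hsm,
    inter_eq_self_of_subset_left (hs.trans hsub), ← setLIntegral_const]
  exact setLIntegral_mono' hsm fun y hy => ENNReal.ofReal_le_ofReal (hle y (hs hy))

/-- Lower bound, of order `r ^ #C`, for the mass of thin slabs. -/
lemma IsPositiveDensityLaw.exists_le_slab [DecidableEq I] {μ : Measure (I → ℝ)}
    [IsProbabilityMeasure μ]
    (h : IsPositiveDensityLaw μ) (x : I → ℝ) (hx : x ∈ posOrthant I) (T C : Finset I) :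
    ∃ δ : ℝ, 0 < δ ∧ ∀ᶠ r in 𝓝[>] (0 : ℝ), δ * r ^ C.card ≤
      μ.real (slab T C (fun i => x i - r) (fun i => if i ∈ C then x i + r else x i)) := by
  -- The density is bounded below on the fixed box `[x/2, 2x]`. For small `r` this contains a box
  -- with sides `2r` on `C` and `x i / 2` off `C`, which lies in the slab; its volume gives the
  -- constant.
  obtain ⟨δ, hδ, hle⟩ := h.exists_le_measure_Icc (fun i => x i / 2) (fun i => 2 * x i)
    (fun i => half_pos (hx i))
  refine ⟨δ * (2 ^ C.card * ∏ i ∈ Cᶜ, x i / 2), ?_, ?_⟩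
  · have : 0 < ∏ i ∈ Cᶜ, x i / 2 := Finset.prod_pos fun i _ => half_pos (hx i)
    positivity
  have hev : ∀ᶠ r in 𝓝[>] (0 : ℝ), ∀ i, r < x i / 2 :=
    eventually_all.2 fun i => mem_nhdsWithin_of_mem_nhds (Iio_mem_nhds (half_pos (hx i)))
  filter_upwards [hev, self_mem_nhdsWithin] with r hr hr0
  rw [mem_Ioi] at hr0
  set l : I → ℝ := fun i => if i ∈ C then x i - r else x i / 2
  set u : I → ℝ := fun i => if i ∈ C then x i + r else x i
  have hIcc : Icc l u ⊆ Icc (fun i => x i / 2) (fun i => 2 * x i) := by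
    refine Icc_subset_Icc (fun i => ?_) (fun i => ?_)
    · have := hr i; have := hx i
      by_cases hi : i ∈ C <;> simp [l, hi]; linarith
    · have := hr i; have := hx i
      by_cases hi : i ∈ C <;> simp [u, hi] <;> linarith
  have hslab : Icc l u ⊆ slab T C (fun i => x i - r) u := by
    refine fun y hy => ⟨fun i _ => hy.2 i, fun i hi => ?_⟩
    have := hy.1 i
    simpa [l, hi] using this
  have h1 := (hle _ hIcc measurableSet_Icc).trans (measure_mono hslab)
  have h2 := ENNReal.toReal_mono (measure_ne_top _ _) h1
  rw [ENNReal.toReal_mul, ENNReal.toReal_ofReal hδ.le, Real.volume_Icc_pi_toReal] at h2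
  · refine le_trans (le_of_eq ?_) h2
    have hC : ∏ i ∈ C, (u i - l i) = ∏ _i ∈ C, 2 * r :=
      Finset.prod_congr rfl fun i hi => by simp [u, l, hi]; ring
    have hCc : ∏ i ∈ Cᶜ, (u i - l i) = ∏ i ∈ Cᶜ, x i / 2 :=
      Finset.prod_congr rfl fun i hi => by
        simp only [Finset.mem_compl] at hi
        simp [u, l, hi]; ring
    rw [← Finset.prod_mul_prod_compl C, hC, hCc, Finset.prod_const, mul_pow]
    ring
  · intro i
    have := hx i
    by_cases hi : i ∈ C <;> simp [l, u, hi] <;> linarith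

lemma quasiMeasurePreserving_subvector (J : Finset I) :
    Measure.QuasiMeasurePreserving (fun (y : I → ℝ) (i : J) => y i) volume volume := by
  classical
  have h1 := (volume_preserving_piEquivPiSubtypeProd (fun _ : I => ℝ) (· ∈ J)).quasiMeasurePreserving
  convert Measure.quasiMeasurePreserving_fst.comp h1 <;> rfl

/-- Almost every point admits, for each set of coordinates, an upper bound of volume order for the
marginal mass of small cubes around it. -/
lemma ae_exists_forall_measure_cube_le {μ : Measure (I → ℝ)} [IsProbabilityMeasure μ]
    (h : μ ≪ volume) :
    ∀ᵐ y ∂μ, ∀ J : Finset I, ∃ K : ℝ, ∀ᶠ r in 𝓝[>] (0 : ℝ),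
      μ.real {z | ∀ i ∈ J, |z i - y i| ≤ r} ≤ K * r ^ J.card := by
  refine ae_all_iff.2 fun J => ?_
  set p : (I → ℝ) → (J → ℝ) := fun y i => y i
  have hp : Measurable p := by fun_prop
  have : IsProbabilityMeasure (μ.map p) := Measure.isProbabilityMeasure_map hp.aemeasurable
  have hae : ∀ᵐ w ∂(volume : Measure (J → ℝ)), ∃ K : ℝ, ∀ᶠ r in 𝓝[>] (0 : ℝ),
      (μ.map p).real (Metric.closedBall w r) ≤ K * r ^ J.card := by
    -- A marginal density may be unbounded, but it is finite almost everywhere and is the limit of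
    -- mass over volume on closed balls, which are cubes in the sup metric. The factor `2 ^ J.card`
    -- below comes from their side `2r`.
    filter_upwards [Besicovitch.ae_tendsto_rnDeriv (μ.map p) volume,
      Measure.rnDeriv_lt_top (μ.map p) volume] with w hw hfin
    obtain ⟨K, hK⟩ := ENNReal.lt_iff_exists_nnreal_btwn.1 hfin
    refine ⟨K * 2 ^ J.card, ?_⟩
    filter_upwards [hw.eventually_lt_const hK.1, self_mem_nhdsWithin] with r hr hr0
    rw [mem_Ioi] at hr0
    have hv : volume (Metric.closedBall w r) = ENNReal.ofReal ((2 * r) ^ J.card) := by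
      simp [Real.volume_pi_closedBall w hr0.le]
    have hpos : 0 < (2 * r) ^ J.card := by positivity
    rw [hv] at hr
    have h1 := (ENNReal.div_le_iff (by simpa using hpos) ENNReal.ofReal_ne_top).1 hr.le
    have h2 := ENNReal.toReal_mono (by finiteness) h1
    rw [ENNReal.toReal_mul, ENNReal.toReal_ofReal hpos.le] at h2
    rw [measureReal_def]
    refine h2.trans (le_of_eq ?_)
    simp; ring
  have h2 := ((quasiMeasurePreserving_subvector J).ae hae)
  filter_upwards [h.ae_le h2] with y hy
  obtain ⟨K, hK⟩ := hy
  refine ⟨K, ?_⟩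
  filter_upwards [hK, self_mem_nhdsWithin] with r hr hr0
  rw [mem_Ioi] at hr0
  rw [map_measureReal_apply hp measurableSet_closedBall] at hr
  convert hr using 2
  ext z
  simp [p, dist_pi_le_iff hr0.le, Real.dist_eq]

end Density

/-- Exponential growth beats polynomial growth: this is the passage to `n`-th roots. -/
lemma le_of_forall_pow_le_mul_pow {a b : ℝ} (ha : 0 < a) (hb : 0 < b) (M : ℝ) (k : ℕ)
    (h : ∀ m : ℕ, a ^ (m + 1) ≤ M * ((m + 1 : ℕ) : ℝ) ^ k * b ^ (m + 1)) : a ≤ b := by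
  by_contra! hlt
  have hq : 1 < a / b := (one_lt_div hb).2 hlt
  have h1 : Tendsto (fun n : ℕ => M * ((n : ℝ) ^ k / (a / b) ^ n)) atTop (𝓝 (M * 0)) :=
    (tendsto_pow_const_div_const_pow_of_one_lt k hq).const_mul M
  have h2 := (tendsto_add_atTop_iff_nat 1).2 h1
  rw [mul_zero] at h2
  obtain ⟨m, hm⟩ := (h2.eventually_lt_const one_pos).exists
  have := h m
  have hbm : 0 < b ^ (m + 1) := by positivity
  have ham : 0 < a ^ (m + 1) := by positivity
  rw [div_pow, div_div_eq_mul_div, ← mul_div_assoc, div_lt_one ham] at hm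
  linarith [mul_assoc M (((m + 1 : ℕ) : ℝ) ^ k) (b ^ (m + 1))]

/-! ### Slab probabilities up to polynomial factors -/

section Sandwich

variable {I : Type*}

/-- The distribution function of the marginal of `μ` on `T`. -/
noncomputable def lawCDF (μ : Measure (I → ℝ)) (T : Finset I) (x : I → ℝ) : ℝ :=
  μ.real {y | ∀ i ∈ T, y i ≤ x i}

lemma slab_empty (T : Finset I) (a b : I → ℝ) : slab T ∅ a b = {y | ∀ i ∈ T, y i ≤ b i} := by
  simp [slab]

lemma lawCDF_mono {μ : Measure (I → ℝ)} [IsProbabilityMeasure μ] (T : Finset I) :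
    Monotone (lawCDF μ T) := fun _ _ hxy =>
  measureReal_mono fun _ hz i hi => (hz i hi).trans (hxy i)


/-- For every `n ≥ 1`, the law of the componentwise maximum of `n` independent vectors with law `μ`
is the image of `μ` under multiplication by `n`. -/
def IsMaxStableLaw (μ : Measure (I → ℝ)) : Prop :=
  ∀ n : ℕ, 0 < n →
    (Measure.pi (fun _ : Fin n => μ)).map (fun y i => ⨆ k : Fin n, y k i)
      = μ.map (fun y i => (n : ℝ) * y i)

lemma IsMaxStableLaw.measureReal_smul {μ : Measure (I → ℝ)} (h : IsMaxStableLaw μ) (m : ℕ)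
    {s : Set (I → ℝ)} (hs : MeasurableSet s) :
    μ.real {y | (fun i => ((m + 1 : ℕ) : ℝ) * y i) ∈ s} =
      (Measure.pi fun _ : Fin (m + 1) => μ).real {y | (fun i => ⨆ k, y k i) ∈ s} := by
  have hm : Measurable fun (y : Fin (m + 1) → I → ℝ) i => ⨆ k, y k i :=
    measurable_pi_lambda _ fun i => Measurable.iSup fun k => by fun_prop
  have h1 : ((Measure.pi (fun _ : Fin (m + 1) => μ)).map (fun y i => ⨆ k, y k i)).real s =
      (μ.map (fun y i => ((m + 1 : ℕ) : ℝ) * y i)).real s := by rw [h (m + 1) m.succ_pos]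
  rw [map_measureReal_apply hm hs, map_measureReal_apply (by fun_prop) hs] at h1
  exact h1.symm

variable [Fintype I]

lemma lawCDF_pos {μ : Measure (I → ℝ)} [IsProbabilityMeasure μ] (h : IsPositiveDensityLaw μ)
    (T : Finset I) {x : I → ℝ} (hx : x ∈ posOrthant I) : 0 < lawCDF μ T x := by
  classical
  obtain ⟨δ, hδ, hev⟩ := h.exists_le_slab x hx T ∅
  obtain ⟨r, hr⟩ := hev.exists
  simp only [slab_empty] at hr
  simp only [Finset.card_empty, pow_zero, mul_one, Finset.notMem_empty, if_false] at hr
  exact hδ.trans_le hr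

variable [DecidableEq I]

/-- The shift of the coordinates in `C` by `r`. -/
def shift (C : Finset I) (x : I → ℝ) (r : ℝ) : I → ℝ := fun i => if i ∈ C then x i + r else x i

/-- The probability that the maximum of `m + 1` independent copies lies below `x` on `T` and within
distance `r` of `x` on `C` is comparable, up to a factor polynomial in `m`, to the volume times the
power of the distribution function. -/
lemma IsMaxStableLaw.exists_sandwich {μ : Measure (I → ℝ)} [IsProbabilityMeasure μ]
    (hmax : IsMaxStableLaw μ) (h : IsPositiveDensityLaw μ) {x : I → ℝ} (hx : x ∈ posOrthant I)
    {T C : Finset I} (hCT : C ⊆ T)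
    (hcube : ∀ J ⊆ C, ∃ K : ℝ, ∀ᶠ r in 𝓝[>] (0 : ℝ),
      μ.real {z | ∀ i ∈ J, |z i - x i| ≤ r} ≤ K * r ^ J.card) :
    ∃ M : ℝ, 0 < M ∧ ∀ᶠ r in 𝓝[>] (0 : ℝ), ∀ m : ℕ,
      M⁻¹ * r ^ C.card * lawCDF μ T (shift C x r) ^ (m + 1) ≤
        μ.real {y | (fun i => ((m + 1 : ℕ) : ℝ) * y i) ∈
          slab T C (fun i => x i - r) (shift C x r)} ∧
      μ.real {y | (fun i => ((m + 1 : ℕ) : ℝ) * y i) ∈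
          slab T C (fun i => x i - r) (shift C x r)} ≤
        M * ((m + 1 : ℕ) : ℝ) ^ Fintype.card I * r ^ C.card *
          lawCDF μ T (shift C x r) ^ (m + 1) := by
  obtain ⟨δ, hδ, hlow⟩ := h.exists_le_slab x hx T C
  have hK : ∀ J : Finset I, ∃ K : ℝ, J ⊆ C → ∀ᶠ r in 𝓝[>] (0 : ℝ),
      μ.real {z | ∀ i ∈ J, |z i - x i| ≤ r} ≤ K * r ^ J.card := by
    intro J
    by_cases hJ : J ⊆ C
    · obtain ⟨K, hK⟩ := hcube J hJ
      exact ⟨K, fun _ => hK⟩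
    · exact ⟨0, fun h => absurd h hJ⟩
  choose K hK using hK
  have hg0 := lawCDF_pos h T hx
  set g0 := lawCDF μ T x
  -- `L` is chosen so that `K J ≤ L * g0`: every copy, including those close to `x` on some
  -- coordinates, then contributes a full factor `g ≥ g0`. As `L ≥ 1`, it may be raised to the power
  -- `J.card`, so the constants multiply to `L ^ C.card` whatever `m` is.
  set L : ℝ := 1 + ∑ J : Finset I, |K J| / g0 with hL
  have hL1 : 1 ≤ L := le_add_of_nonneg_right (Finset.sum_nonneg fun J _ => by positivity)
  have hKL : ∀ J, K J ≤ L * g0 := by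
    intro J
    have h1 : |K J| / g0 ≤ L := by
      refine (Finset.single_le_sum (f := fun J => |K J| / g0) (fun J _ => ?_)
        (Finset.mem_univ J)).trans (le_add_of_nonneg_left zero_le_one)
      positivity
    exact (le_abs_self _).trans ((div_le_iff₀ hg0).1 h1)
  have hup : ∀ᶠ r in 𝓝[>] (0 : ℝ), ∀ J, J ⊆ C →
      μ.real {z | ∀ i ∈ J, |z i - x i| ≤ r} ≤ K J * r ^ J.card := by
    refine eventually_all.2 fun J => ?_
    by_cases hJ : J ⊆ C
    · exact (hK J hJ).mono fun r hr _ => hr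
    · exact Eventually.of_forall fun r hr => absurd hr hJ
  refine ⟨max (L ^ C.card) δ⁻¹, by positivity, ?_⟩
  filter_upwards [hlow, hup, self_mem_nhdsWithin] with r hlr hur hr0 m
  rw [mem_Ioi] at hr0
  set a : I → ℝ := fun i => x i - r
  set b := shift C x r
  set g := lawCDF μ T b
  have hgb : g0 ≤ g := lawCDF_mono T fun i => by
    simp only [b, shift]; split_ifs <;> linarith
  have hg : 0 < g := hg0.trans_le hgb
  have hg1 : g ≤ 1 := measureReal_le_one
  have hge : μ.real (slab T ∅ a b) = g := by rw [slab_empty]; rfl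
  rw [hmax.measureReal_smul m (measurableSet_slab _ _ _ _)]
  constructor
  · refine le_trans ?_ (le_iSup_mem_slab μ T C a b m)
    rw [hge, pow_succ g m]
    have h1 : (max (L ^ C.card) δ⁻¹)⁻¹ ≤ δ := by
      rw [inv_le_comm₀ (by positivity) hδ]; exact le_max_right _ _
    calc _ ≤ δ * r ^ C.card * (g ^ m * 1) := by gcongr
      _ ≤ _ := by rw [mul_one]; gcongr; exact hlr
  · refine (iSup_mem_slab_le μ T C a b m).trans ?_
    have hJ : ∀ J ⊆ C, μ.real (slab T J a b) ≤ g * (L * r) ^ J.card := by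
      intro J hJ
      rcases J.eq_empty_or_nonempty with rfl | hne
      · simp [hge]
      · calc μ.real (slab T J a b) ≤ μ.real {z | ∀ i ∈ J, |z i - x i| ≤ r} := by
              refine measureReal_mono fun z hz i hi => ?_
              have h1 := hz.1 i (hCT (hJ hi))
              have h2 := hz.2 i hi
              simp only [b, shift, hJ hi, if_true, a] at h1 h2
              rw [abs_le]; constructor <;> linarith
          _ ≤ K J * r ^ J.card := hur J hJ
          _ ≤ L ^ J.card * g * r ^ J.card := by
              gcongr
              refine (hKL J).trans ?_
              gcongr
              exact le_self_pow₀ hL1 hne.card_ne_zero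
          _ = _ := by rw [mul_pow]; ring
    -- The fibres of `σ` partition `C`, so the powers of `L * r` always add up to `C.card`.
    have hterm : ∀ σ : I → Fin (m + 1),
        ∏ k, μ.real (slab T (C.filter (σ · = k)) a b) ≤ g ^ (m + 1) * (L * r) ^ C.card := by
      intro σ
      calc _ ≤ ∏ k : Fin (m + 1), g * (L * r) ^ (C.filter (σ · = k)).card :=
            Finset.prod_le_prod (fun _ _ => measureReal_nonneg)
              fun k _ => hJ _ (Finset.filter_subset _ _)
        _ = _ := by
            rw [Finset.prod_mul_distrib, Finset.prod_const, Finset.prod_pow_eq_pow_sum,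
              ← Finset.card_eq_sum_card_fiberwise (fun _ _ => Finset.mem_coe.2 (Finset.mem_univ _))]
            simp
    calc _ ≤ ∑ _σ : I → Fin (m + 1), g ^ (m + 1) * (L * r) ^ C.card :=
          Finset.sum_le_sum fun σ _ => hterm σ
      _ = L ^ C.card * ((m + 1 : ℕ) : ℝ) ^ Fintype.card I * r ^ C.card * g ^ (m + 1) := by
          rw [Finset.sum_const, Finset.card_univ, Fintype.card_fun, Fintype.card_fin,
            nsmul_eq_mul, mul_pow]
          push_cast
          ring
      _ ≤ _ := by gcongr; exact le_max_left _ _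

end Sandwich

/-! ### From limiting ratios to ratios of bases -/

section Ratio

/-- Two-sided bounds of `N m r` by `r ^ c * g r ^ (m + 1)`, up to factors polynomial in `m`. -/
def PolySandwich (k c : ℕ) (g : ℝ → ℝ) (N : ℕ → ℝ → ℝ) : Prop :=
  ∃ M : ℝ, 0 < M ∧ ∀ᶠ r in 𝓝[>] (0 : ℝ), ∀ m : ℕ,
    M⁻¹ * r ^ c * g r ^ (m + 1) ≤ N m r ∧
      N m r ≤ M * ((m + 1 : ℕ) : ℝ) ^ k * r ^ c * g r ^ (m + 1)

/-- The factors `r ^ c` cancel in `N m r / N₀ m r`, so the bounds survive the limit `r → 0` at fixed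
`m`. What matters is that `M` is chosen before `m`. -/
lemma PolySandwich.exists_bound {k c : ℕ} {g g₀ : ℝ → ℝ} {N N₀ : ℕ → ℝ → ℝ}
    (h : PolySandwich k c g N) (h₀ : PolySandwich k c g₀ N₀) {G G₀ : ℝ} (hG : 0 < G) (hG₀ : 0 < G₀)
    (hg : Tendsto g (𝓝[>] 0) (𝓝 G)) (hg₀ : Tendsto g₀ (𝓝[>] 0) (𝓝 G₀)) :
    ∃ M : ℝ, 0 < M ∧ ∀ (m : ℕ) (F : ℝ),
      Tendsto (fun r => N m r / N₀ m r) (𝓝[>] 0) (𝓝 F) →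
      F * G₀ ^ (m + 1) ≤ M * ((m + 1 : ℕ) : ℝ) ^ k * G ^ (m + 1) := by
  obtain ⟨M, hM, hN⟩ := h
  obtain ⟨M₀, hM₀, hN₀⟩ := h₀
  refine ⟨M * M₀, by positivity, fun m F hF => ?_⟩
  have h1 : Tendsto (fun r => N m r / N₀ m r * g₀ r ^ (m + 1)) (𝓝[>] 0)
      (𝓝 (F * G₀ ^ (m + 1))) := hF.mul (hg₀.pow _)
  have h2 : Tendsto (fun r => M * M₀ * ((m + 1 : ℕ) : ℝ) ^ k * g r ^ (m + 1)) (𝓝[>] 0)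
      (𝓝 (M * M₀ * ((m + 1 : ℕ) : ℝ) ^ k * G ^ (m + 1))) := (hg.pow _).const_mul _
  refine le_of_tendsto_of_tendsto h1 h2 ?_
  filter_upwards [hN, hN₀, self_mem_nhdsWithin, hg.eventually (lt_mem_nhds hG),
    hg₀.eventually (lt_mem_nhds hG₀)] with r hr hr₀ hr0 hgr hgr₀
  rw [mem_Ioi] at hr0
  have hpos : 0 < M₀⁻¹ * r ^ c * g₀ r ^ (m + 1) := by positivity
  have hN0 : 0 < N₀ m r := hpos.trans_le (hr₀ m).1
  rw [div_mul_eq_mul_div, div_le_iff₀ hN0]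
  calc N m r * g₀ r ^ (m + 1)
      ≤ M * ((m + 1 : ℕ) : ℝ) ^ k * r ^ c * g r ^ (m + 1) * g₀ r ^ (m + 1) := by
        gcongr; exact (hr m).2
    _ = M * M₀ * ((m + 1 : ℕ) : ℝ) ^ k * g r ^ (m + 1) * (M₀⁻¹ * r ^ c * g₀ r ^ (m + 1)) := by
        field_simp
    _ ≤ _ := by gcongr; exact (hr₀ m).1

lemma PolySandwich.exists_bound_inv {k c : ℕ} {g g₀ : ℝ → ℝ} {N N₀ : ℕ → ℝ → ℝ}
    (h : PolySandwich k c g N) (h₀ : PolySandwich k c g₀ N₀) {G G₀ : ℝ} (hG : 0 < G) (hG₀ : 0 < G₀)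
    (hg : Tendsto g (𝓝[>] 0) (𝓝 G)) (hg₀ : Tendsto g₀ (𝓝[>] 0) (𝓝 G₀)) :
    ∃ M : ℝ, 0 < M ∧ ∀ (m : ℕ) (F : ℝ),
      Tendsto (fun r => N m r / N₀ m r) (𝓝[>] 0) (𝓝 F) →
      G ^ (m + 1) ≤ M * ((m + 1 : ℕ) : ℝ) ^ k * (F * G₀ ^ (m + 1)) := by
  obtain ⟨M, hM, hN⟩ := h
  obtain ⟨M₀, hM₀, hN₀⟩ := h₀
  refine ⟨M * M₀, by positivity, fun m F hF => ?_⟩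
  have h1 : Tendsto (fun r => M * M₀ * ((m + 1 : ℕ) : ℝ) ^ k * (N m r / N₀ m r * g₀ r ^ (m + 1)))
      (𝓝[>] 0) (𝓝 (M * M₀ * ((m + 1 : ℕ) : ℝ) ^ k * (F * G₀ ^ (m + 1)))) :=
    (hF.mul (hg₀.pow _)).const_mul _
  refine le_of_tendsto_of_tendsto (hg.pow _) h1 ?_
  filter_upwards [hN, hN₀, self_mem_nhdsWithin, hg.eventually (lt_mem_nhds hG),
    hg₀.eventually (lt_mem_nhds hG₀)] with r hr hr₀ hr0 hgr hgr₀
  rw [mem_Ioi] at hr0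
  have hpos : 0 < M₀⁻¹ * r ^ c * g₀ r ^ (m + 1) := by positivity
  have hN0 : 0 < N₀ m r := hpos.trans_le (hr₀ m).1
  rw [div_mul_eq_mul_div, ← mul_div_assoc, le_div_iff₀ hN0]
  calc g r ^ (m + 1) * N₀ m r
      ≤ g r ^ (m + 1) * (M₀ * ((m + 1 : ℕ) : ℝ) ^ k * r ^ c * g₀ r ^ (m + 1)) := by
        gcongr; exact (hr₀ m).2
    _ = M * M₀ * ((m + 1 : ℕ) : ℝ) ^ k * (M⁻¹ * r ^ c * g r ^ (m + 1) * g₀ r ^ (m + 1)) := by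
        field_simp
    _ ≤ _ := by gcongr; exact (hr m).1

/-- If the limiting ratios multiply for every `m`, then so do the ratios of the bases. -/
lemma mul_eq_mul_of_polySandwich {k c : ℕ} {g : Fin 4 → ℝ → ℝ} {N : Fin 4 → ℕ → ℝ → ℝ}
    {G : Fin 4 → ℝ} (h : ∀ j, PolySandwich k c (g j) (N j)) (hG : ∀ j, 0 < G j)
    (hg : ∀ j, Tendsto (g j) (𝓝[>] 0) (𝓝 (G j))) {F : Fin 4 → ℕ → ℝ}
    (hF : ∀ j m, Tendsto (fun r => N j m r / N 0 m r) (𝓝[>] 0) (𝓝 (F j m)))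
    (hmul : ∀ m, F 3 m = F 1 m * F 2 m) : G 3 * G 0 = G 1 * G 2 := by
  have hup : ∀ j, ∃ M : ℝ, 0 < M ∧ ∀ m, F j m * G 0 ^ (m + 1) ≤
      M * ((m + 1 : ℕ) : ℝ) ^ k * G j ^ (m + 1) := fun j => by
    obtain ⟨M, hM, hb⟩ := (h j).exists_bound (h 0) (hG j) (hG 0) (hg j) (hg 0)
    exact ⟨M, hM, fun m => hb m _ (hF j m)⟩
  have hlo : ∀ j, ∃ M : ℝ, 0 < M ∧ ∀ m, G j ^ (m + 1) ≤
      M * ((m + 1 : ℕ) : ℝ) ^ k * (F j m * G 0 ^ (m + 1)) := fun j => by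
    obtain ⟨M, hM, hb⟩ := (h j).exists_bound_inv (h 0) (hG j) (hG 0) (hg j) (hg 0)
    exact ⟨M, hM, fun m => hb m _ (hF j m)⟩
  choose U hU hup using hup
  choose L hL hlo using hlo
  have hpos : ∀ j m, 0 < F j m * G 0 ^ (m + 1) := fun j m => by
    have h1 := (pow_pos (hG j) (m + 1)).trans_le (hlo j m)
    have h2 : 0 < L j * ((m + 1 : ℕ) : ℝ) ^ k := by have := hL j; positivity
    exact pos_of_mul_pos_right h1 h2.le
  have h0 := hG 0
  have h1 := hG 1
  have h2 := hG 2
  have h3 := hG 3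
  apply le_antisymm
  -- Three of the bounds are combined, each costing a factor of degree `k` in `m + 1`.
  · refine le_of_forall_pow_le_mul_pow (by positivity) (by positivity) (L 3 * U 1 * U 2) (3 * k)
      fun m => ?_
    have hL3 := hL 3
    calc (G 3 * G 0) ^ (m + 1) = G 3 ^ (m + 1) * G 0 ^ (m + 1) := mul_pow _ _ _
      _ ≤ L 3 * ((m + 1 : ℕ) : ℝ) ^ k * (F 3 m * G 0 ^ (m + 1)) * G 0 ^ (m + 1) := by
          gcongr; exact hlo 3 m
      _ = L 3 * ((m + 1 : ℕ) : ℝ) ^ k * ((F 1 m * G 0 ^ (m + 1)) * (F 2 m * G 0 ^ (m + 1))) := by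
          rw [hmul]; ring
      _ ≤ L 3 * ((m + 1 : ℕ) : ℝ) ^ k * ((U 1 * ((m + 1 : ℕ) : ℝ) ^ k * G 1 ^ (m + 1)) *
            (U 2 * ((m + 1 : ℕ) : ℝ) ^ k * G 2 ^ (m + 1))) := by
          refine mul_le_mul_of_nonneg_left ?_ (by positivity)
          exact mul_le_mul (hup 1 m) (hup 2 m) (hpos 2 m).le ((hpos 1 m).le.trans (hup 1 m))
      _ = _ := by rw [mul_pow]; ring
  · refine le_of_forall_pow_le_mul_pow (by positivity) (by positivity) (U 3 * L 1 * L 2) (3 * k)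
      fun m => ?_
    have hL1 := hL 1
    have hL2 := hL 2
    calc (G 1 * G 2) ^ (m + 1) = G 1 ^ (m + 1) * G 2 ^ (m + 1) := mul_pow _ _ _
      _ ≤ (L 1 * ((m + 1 : ℕ) : ℝ) ^ k * (F 1 m * G 0 ^ (m + 1))) *
            (L 2 * ((m + 1 : ℕ) : ℝ) ^ k * (F 2 m * G 0 ^ (m + 1))) := by
          have := (hpos 1 m).le
          exact mul_le_mul (hlo 1 m) (hlo 2 m) (by positivity) (by positivity)
      _ = L 1 * L 2 * ((m + 1 : ℕ) : ℝ) ^ (2 * k) * ((F 3 m * G 0 ^ (m + 1)) * G 0 ^ (m + 1)) := by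
          rw [hmul]; ring
      _ ≤ L 1 * L 2 * ((m + 1 : ℕ) : ℝ) ^ (2 * k) *
            ((U 3 * ((m + 1 : ℕ) : ℝ) ^ k * G 3 ^ (m + 1)) * G 0 ^ (m + 1)) := by
          refine mul_le_mul_of_nonneg_left ?_ (by positivity)
          exact mul_le_mul_of_nonneg_right (hup 3 m) (by positivity)
      _ = _ := by rw [mul_pow]; ring

end Ratio

/-! ### Conditional probabilities as Radon–Nikodym derivatives -/

section CondExp

variable {Ω γ : Type*} [MeasurableSpace Ω] [mγ : MeasurableSpace γ]

/-- The conditional probability of `E` given `Z` is the density of the law of `Z` on `E` with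
respect to the law of `Z`. -/
lemma condExp_indicator_ae_eq_rnDeriv (P : Measure Ω) [IsProbabilityMeasure P] {Z : Ω → γ}
    (hZ : Measurable Z) {E : Set Ω} (hE : MeasurableSet E) :
    P[E.indicator (fun _ => (1 : ℝ)) | mγ.comap Z] =ᵐ[P]
      fun ω => (((P.restrict E).map Z).rnDeriv (P.map Z) (Z ω)).toReal := by
  have hac : (P.restrict E).map Z ≪ P.map Z := Measure.restrict_le_self.absolutelyContinuous.map hZ
  have : IsProbabilityMeasure (P.map Z) := Measure.isProbabilityMeasure_map hZ.aemeasurable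
  have hmeas : Measurable fun z => (((P.restrict E).map Z).rnDeriv (P.map Z) z).toReal := by
    fun_prop
  have hint : Integrable (fun ω => (((P.restrict E).map Z).rnDeriv (P.map Z) (Z ω)).toReal) P :=
    (integrable_map_measure hmeas.aestronglyMeasurable hZ.aemeasurable).1
      Measure.integrable_toReal_rnDeriv
  refine (ae_eq_condExp_of_forall_setIntegral_eq hZ.comap_le
    ((integrable_const _).indicator hE) (fun _ _ _ => hint.integrableOn) ?_ ?_).symm
  · rintro _ ⟨s, hs, rfl⟩ -
    rw [← setIntegral_map hs hmeas.aestronglyMeasurable hZ.aemeasurable,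
      Measure.setIntegral_toReal_rnDeriv hac, map_measureReal_apply hZ hs,
      measureReal_restrict_apply (hZ hs), setIntegral_indicator hE]
    simp
  · exact (hmeas.comp (comap_measurable Z)).stronglyMeasurable.aestronglyMeasurable

end CondExp

/-! ### Continuity and scaling of null sets -/

section Continuity

variable {I : Type*} [Fintype I]

lemma continuous_lawCDF {μ : Measure (I → ℝ)} [IsProbabilityMeasure μ] (h : μ ≪ volume)
    (T : Finset I) : Continuous (lawCDF μ T) := by
  have hm : ∀ x : I → ℝ, MeasurableSet {y : I → ℝ | ∀ i ∈ T, y i ≤ x i} := fun x => by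
    rw [← slab_empty T x x]; exact measurableSet_slab _ _ _ _
  have heq : lawCDF μ T = fun x => ∫ y, {y : I → ℝ | ∀ i ∈ T, y i ≤ x i}.indicator
      (fun _ => (1 : ℝ)) y ∂μ := by
    ext x
    rw [integral_indicator (hm x)]
    simp [lawCDF]
  rw [heq, continuous_iff_continuousAt]
  intro x
  refine continuousAt_of_dominated (bound := fun _ => 1) ?_ ?_ (integrable_const _) ?_
  · exact Eventually.of_forall fun z => (aestronglyMeasurable_const.indicator (hm z))
  · refine Eventually.of_forall fun z => Eventually.of_forall fun y => ?_
    refine (norm_indicator_le_norm_self _ _).trans (by simp)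
  -- Off the null hyperplanes `y i = x i`, the indicator is locally constant in its bound near `x`,
  -- so dominated convergence applies.
  · have hne : ∀ᵐ y ∂μ, ∀ i, y i ≠ x i := ae_all_iff.2 fun i =>
      h.ae_le (Measure.ae_eval_ne (μ := fun _ : I => (volume : Measure ℝ)) i (x i))
    filter_upwards [hne] with y hy
    have hev : ∀ᶠ z in 𝓝 x, ∀ i, (y i ≤ z i ↔ y i ≤ x i) := by
      refine eventually_all.2 fun i => ?_
      have hc : Tendsto (fun z : I → ℝ => z i) (𝓝 x) (𝓝 (x i)) := (continuous_apply i).tendsto x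
      rcases (hy i).lt_or_gt with hlt | hgt
      · filter_upwards [hc.eventually (lt_mem_nhds hlt)] with z hz
        exact ⟨fun _ => hlt.le, fun _ => hz.le⟩
      · filter_upwards [hc.eventually (gt_mem_nhds hgt)] with z hz
        exact ⟨fun h => absurd h hz.not_ge, fun h => absurd h hgt.not_ge⟩
    refine (continuousAt_const (y := {y : I → ℝ | ∀ i ∈ T, y i ≤ x i}.indicator
      (fun _ => (1 : ℝ)) y)).congr ?_
    filter_upwards [hev] with z hz
    simp only [indicator, mem_ofPred_eq, hz]

/-- `μ` has the same null sets as Lebesgue measure on the orthant, which positive dilations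
preserve. This lets almost sure statements be evaluated at `y / n`. -/
lemma IsPositiveDensityLaw.quasiMeasurePreserving_smul {μ : Measure (I → ℝ)}
    (h : IsPositiveDensityLaw μ) {c : ℝ} (hc : 0 < c) :
    Measure.QuasiMeasurePreserving (fun y : I → ℝ => c • y) μ μ := by
  refine ⟨by fun_prop, ?_⟩
  refine (h.absolutelyContinuous.map (by fun_prop)).trans
    (Measure.AbsolutelyContinuous.trans ?_ h.restrict_absolutelyContinuous)
  refine Measure.AbsolutelyContinuous.mk fun s hs h0 => ?_
  have hO := isOpen_posOrthant (I := I).measurableSet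
  rw [Measure.restrict_apply hs] at h0
  rw [Measure.map_apply (by fun_prop) hs, Measure.restrict_apply (hs.preimage (by fun_prop))]
  have : (fun y : I → ℝ => c • y) ⁻¹' s ∩ posOrthant I = (c • ·) ⁻¹' (s ∩ posOrthant I) := by
    ext y; simp [posOrthant, hc]
  rw [this, Measure.addHaar_preimage_smul _ hc.ne', h0, mul_zero]

/-- A continuous function vanishing almost everywhere vanishes on the orthant. -/
lemma IsPositiveDensityLaw.eq_zero_of_ae {μ : Measure (I → ℝ)} (h : IsPositiveDensityLaw μ)
    {φ : (I → ℝ) → ℝ} (hφ : Continuous φ) (h0 : ∀ᵐ y ∂μ, φ y = 0) {x : I → ℝ}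
    (hx : x ∈ posOrthant I) : φ x = 0 := by
  by_contra hne
  have h1 : ∀ᵐ y ∂volume.restrict (posOrthant I), φ y = 0 :=
    h.restrict_absolutelyContinuous.ae_le h0
  rw [ae_restrict_iff' isOpen_posOrthant.measurableSet] at h1
  have hopen : IsOpen ({y | φ y ≠ 0} ∩ posOrthant I) :=
    (isOpen_ne_fun hφ continuous_const).inter isOpen_posOrthant
  have hpos := hopen.measure_pos volume ⟨x, hne, hx⟩
  refine hpos.ne' (measure_mono_null ?_ (ae_iff.1 h1))
  rintro y ⟨hy, hyo⟩ hcon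
  exact hy (hcon hyo)

end Continuity

/-! ### Conditional probabilities at scale `1/n` -/

section Conditional

variable {I : Type*}

lemma measurableSet_forall_le (S : Finset I) (t : I → ℝ) :
    MeasurableSet {z : I → ℝ | ∀ i ∈ S, z i ≤ t i} := by
  rw [← slab_empty S t t]
  exact measurableSet_slab _ _ _ _

/-- The law of the coordinates in `C` on the event that those in `S` are bounded by `t`. -/
noncomputable def boundedLaw (μ : Measure (I → ℝ)) (C S : Finset I) (t : I → ℝ) :
    Measure (C → ℝ) :=
  (μ.restrict {z | ∀ i ∈ S, z i ≤ t i}).map fun z i => z i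

instance (μ : Measure (I → ℝ)) [IsProbabilityMeasure μ] (C S : Finset I) (t : I → ℝ) :
    IsFiniteMeasure (boundedLaw μ C S t) := by
  unfold boundedLaw; infer_instance

/-- A version of the conditional probability, given the coordinates in `C`, that those in `S` are
bounded by `t`. -/
noncomputable def boundedCondProb (μ : Measure (I → ℝ)) (C S : Finset I) (t : I → ℝ)
    (w : C → ℝ) : ℝ :=
  ((boundedLaw μ C S t).rnDeriv (boundedLaw μ C ∅ t) w).toReal

lemma measurable_boundedCondProb (μ : Measure (I → ℝ)) (C S : Finset I) (t : I → ℝ) :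
    Measurable (boundedCondProb μ C S t) := by
  unfold boundedCondProb
  fun_prop

lemma boundedLaw_empty (μ : Measure (I → ℝ)) (C : Finset I) (t : I → ℝ) :
    boundedLaw μ C ∅ t = μ.map fun z (i : C) => z i := by
  simp [boundedLaw]

lemma measurableSet_forall_subtype_le (S : Finset I) (t : I → ℝ) :
    MeasurableSet {z : S → ℝ | ∀ i : S, z i ≤ t i} := by
  have : {z : S → ℝ | ∀ i : S, z i ≤ t i} = ⋂ i : S, {z | z i ≤ t i} := by ext; simp
  rw [this]
  exact MeasurableSet.iInter fun i => measurableSet_le (measurable_pi_apply i) measurable_const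

/-- This is Besicovitch differentiation of one law on `ℝ^C` with respect to another; it identifies
the limiting ratios of slab probabilities. -/
lemma ae_tendsto_boundedCondProb (μ : Measure (I → ℝ)) [IsProbabilityMeasure μ] (C S : Finset I)
    (t : I → ℝ) : ∀ᵐ w ∂(boundedLaw μ C ∅ t),
      Tendsto (fun r => (boundedLaw μ C S t).real (Metric.closedBall w r) /
        (boundedLaw μ C ∅ t).real (Metric.closedBall w r)) (𝓝[>] 0)
          (𝓝 (boundedCondProb μ C S t w)) := by
  filter_upwards [Besicovitch.ae_tendsto_rnDeriv (boundedLaw μ C S t) (boundedLaw μ C ∅ t),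
    Measure.rnDeriv_lt_top (boundedLaw μ C S t) (boundedLaw μ C ∅ t)] with w hw hfin
  have := (ENNReal.tendsto_toReal hfin.ne).comp hw
  simpa only [Function.comp_def, ENNReal.toReal_div, measureReal_def, boundedCondProb] using this

variable [DecidableEq I]

/-- The vector equal to `y` on `C` and to `t` off `C`. -/
def glue (C : Finset I) (t y : I → ℝ) : I → ℝ := fun i => if i ∈ C then y i else t i

/-- Dividing by `c` turns the two-sided bounds on `C` into a sup-norm ball of radius `r / c` around
`y / c`, and the bounds on `S` into `t / c`. -/
lemma measureReal_smul_mem_slab (μ : Measure (I → ℝ)) {C S : Finset I} (hSC : Disjoint S C)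
    (t y : I → ℝ) {r c : ℝ} (hr : 0 < r) (hc : 0 < c) :
    μ.real {z | (fun i => c * z i) ∈ slab (S ∪ C) C (fun i => glue C t y i - r)
        (shift C (glue C t y) r)} =
      (boundedLaw μ C S (c⁻¹ • t)).real
        (Metric.closedBall (fun i : C => (c⁻¹ • y) i) (c⁻¹ * r)) := by
  have hcr : 0 ≤ c⁻¹ * r := by positivity
  rw [boundedLaw, map_measureReal_apply (by fun_prop) measurableSet_closedBall,
    measureReal_restrict_apply (measurableSet_closedBall.preimage (by fun_prop))]
  congr 1
  ext z
  have hS : ∀ i ∈ S, i ∉ C := fun i hi => Finset.disjoint_left.1 hSC hi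
  have e1 : ∀ i ∈ S, (c * z i ≤ shift C (glue C t y) r i ↔ z i ≤ (c⁻¹ • t) i) := fun i hi => by
    simp [shift, glue, hS i hi, le_inv_mul_iff₀ hc]
  have e2 : ∀ i ∈ C, ((c * z i ≤ shift C (glue C t y) r i ∧ glue C t y i - r ≤ c * z i) ↔
      |z i - (c⁻¹ • y) i| ≤ c⁻¹ * r) := fun i hi => by
    have : |c * z i - y i| = c * |z i - c⁻¹ * y i| := by
      rw [← abs_of_pos hc, ← abs_mul, abs_of_pos hc, mul_sub, mul_inv_cancel_left₀ hc.ne']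
    simp only [shift, glue, hi, if_true, Pi.smul_apply, smul_eq_mul]
    rw [le_inv_mul_iff₀ hc, ← this, abs_le]
    constructor <;> rintro ⟨h1, h2⟩ <;> constructor <;> linarith
  simp only [slab, Finset.mem_union, mem_inter_iff, mem_preimage, Metric.mem_closedBall,
    dist_pi_le_iff hcr, Real.dist_eq, mem_ofPred_eq, Subtype.forall]
  constructor
  · rintro ⟨h1, h2⟩
    exact ⟨fun i hi => (e2 i hi).1 ⟨h1 i (Or.inr hi), h2 i hi⟩,
      fun i hi => (e1 i hi).1 (h1 i (Or.inl hi))⟩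
  · rintro ⟨h1, h2⟩
    refine ⟨fun i hi => ?_, fun i hi => ((e2 i hi).2 (h1 i hi)).2⟩
    rcases hi with hi | hi
    · exact (e1 i hi).2 (h2 i hi)
    · exact ((e2 i hi).2 (h1 i hi)).1

/-- If, for all bounds, the conditional probabilities given the coordinates in `C` factorise over
`A` and `B`, then so do the corresponding ratios of distribution functions. -/
lemma IsMaxStableLaw.lawCDF_mul_eq [Fintype I] {μ : Measure (I → ℝ)} [IsProbabilityMeasure μ]
    (hmax : IsMaxStableLaw μ) (h : IsPositiveDensityLaw μ) (A B C : Finset I)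
    (hAC : Disjoint A C) (hBC : Disjoint B C)
    (hcond : ∀ t : I → ℝ, ∀ᵐ w ∂(boundedLaw μ C ∅ t), boundedCondProb μ C (A ∪ B) t w =
      boundedCondProb μ C A t w * boundedCondProb μ C B t w)
    {t : I → ℝ} (ht : t ∈ posOrthant I) :
    lawCDF μ (A ∪ B ∪ C) t * lawCDF μ C t = lawCDF μ (A ∪ C) t * lawCDF μ (B ∪ C) t := by
  have hvol : μ ≪ volume := h.absolutelyContinuous.trans Measure.restrict_le_self.absolutelyContinuous
  have hcont := fun T => continuous_lawCDF hvol T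
  -- Index `0` is the common denominator; the order matches `G 3 * G 0 = G 1 * G 2`.
  set S : Fin 4 → Finset I := ![∅, A, B, A ∪ B] with hS
  have hSC : ∀ j, Disjoint (S j) C := by
    intro j
    fin_cases j
    · exact Finset.disjoint_empty_left _
    · exact hAC
    · exact hBC
    · exact Finset.disjoint_union_left.2 ⟨hAC, hBC⟩
  have hae : ∀ᵐ y ∂μ, lawCDF μ (A ∪ B ∪ C) (glue C t y) * lawCDF μ C (glue C t y) -
      lawCDF μ (A ∪ C) (glue C t y) * lawCDF μ (B ∪ C) (glue C t y) = 0 := by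
    -- Only the countably many bounds `t / (m + 1)` occur, so one null set of `y` serves all `m`.
    have hgood : ∀ m : ℕ, ∀ᵐ y ∂μ, ∀ w : C → ℝ,
        w = (fun i : C => ((((m + 1 : ℕ) : ℝ))⁻¹ • y) i) →
        (boundedCondProb μ C (A ∪ B) ((((m + 1 : ℕ) : ℝ))⁻¹ • t) w =
          boundedCondProb μ C A ((((m + 1 : ℕ) : ℝ))⁻¹ • t) w *
            boundedCondProb μ C B ((((m + 1 : ℕ) : ℝ))⁻¹ • t) w) ∧
        ∀ j, Tendsto (fun r =>
          (boundedLaw μ C (S j) ((((m + 1 : ℕ) : ℝ))⁻¹ • t)).real (Metric.closedBall w r) /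
          (boundedLaw μ C ∅ ((((m + 1 : ℕ) : ℝ))⁻¹ • t)).real (Metric.closedBall w r)) (𝓝[>] 0)
          (𝓝 (boundedCondProb μ C (S j) ((((m + 1 : ℕ) : ℝ))⁻¹ • t) w)) := by
      intro m
      set c : ℝ := (((m + 1 : ℕ) : ℝ))⁻¹
      have hc : 0 < c := by positivity
      have h1 := (hcond (c • t)).and
        (ae_all_iff.2 fun j => ae_tendsto_boundedCondProb μ C (S j) (c • t))
      rw [boundedLaw_empty] at h1
      have hp : Measurable fun (z : I → ℝ) (i : C) => z i := by fun_prop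
      have h2 := ae_of_ae_map hp.aemeasurable h1
      filter_upwards [(h.quasiMeasurePreserving_smul hc).ae h2] with y hy
      rintro w rfl
      rw [← boundedLaw_empty μ C (c • t)] at hy
      exact hy
    have hposae : ∀ᵐ y ∂μ, y ∈ posOrthant I :=
      h.absolutelyContinuous.ae_le (ae_restrict_mem isOpen_posOrthant.measurableSet)
    filter_upwards [ae_all_iff.2 hgood, hposae, ae_exists_forall_measure_cube_le hvol]
      with y hy hypos hcube
    set x := glue C t y
    have hx : x ∈ posOrthant I := fun i => by
      simp only [x, glue]; split_ifs; exacts [hypos i, ht i]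
    have hcube' : ∀ J ⊆ C, ∃ K : ℝ, ∀ᶠ r in 𝓝[>] (0 : ℝ),
        μ.real {z | ∀ i ∈ J, |z i - x i| ≤ r} ≤ K * r ^ J.card := by
      intro J hJ
      obtain ⟨K, hK⟩ := hcube J
      refine ⟨K, hK.mono fun r hr => ?_⟩
      convert hr using 5 with z i
      refine forall_congr' fun hi => ?_
      simp only [x, glue, hJ hi, if_true]
    have hsand : ∀ j, PolySandwich (Fintype.card I) C.card
        (fun r => lawCDF μ (S j ∪ C) (shift C x r))
        (fun m r => μ.real {z | (fun i => ((m + 1 : ℕ) : ℝ) * z i) ∈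
          slab (S j ∪ C) C (fun i => x i - r) (shift C x r)}) := fun j =>
      hmax.exists_sandwich h hx Finset.subset_union_right hcube'
    have hlim : ∀ j, Tendsto (fun r => lawCDF μ (S j ∪ C) (shift C x r)) (𝓝[>] 0)
        (𝓝 (lawCDF μ (S j ∪ C) x)) := by
      intro j
      have hsh : Continuous (shift C x) := by
        refine continuous_pi fun i => ?_
        simp only [shift]
        split_ifs <;> fun_prop
      have h0 : shift C x 0 = x := by ext i; simp [shift]
      have := ((hcont (S j ∪ C)).comp hsh).tendsto 0
      simp only [Function.comp_apply, h0] at this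
      exact this.mono_left nhdsWithin_le_nhds
    have key := mul_eq_mul_of_polySandwich hsand (fun j => lawCDF_pos h (S j ∪ C) hx) hlim
      (F := fun j m => boundedCondProb μ C (S j) ((((m + 1 : ℕ) : ℝ))⁻¹ • t)
        (fun i : C => ((((m + 1 : ℕ) : ℝ))⁻¹ • y) i)) ?_ (fun m => (hy m _ rfl).1)
    · rw [sub_eq_zero]
      simpa [hS] using key
    · intro j m
      have hc : (0 : ℝ) < ((m + 1 : ℕ) : ℝ) := by positivity
      have h1 := (hy m _ rfl).2 j
      have h2 : Tendsto (fun r : ℝ => (((m + 1 : ℕ) : ℝ))⁻¹ * r) (𝓝[>] 0) (𝓝[>] 0) := by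
        refine tendsto_nhdsWithin_iff.2 ⟨?_, ?_⟩
        · have : Tendsto (fun r : ℝ => (((m + 1 : ℕ) : ℝ))⁻¹ * r) (𝓝 0)
              (𝓝 ((((m + 1 : ℕ) : ℝ))⁻¹ * 0)) := (continuous_const_mul _).tendsto 0
          rw [mul_zero] at this
          exact this.mono_left nhdsWithin_le_nhds
        · filter_upwards [self_mem_nhdsWithin] with r hr
          exact mul_pos (inv_pos.2 hc) hr
      refine (h1.comp h2).congr' ?_
      filter_upwards [self_mem_nhdsWithin] with r hr
      simp only [Function.comp_apply]
      rw [measureReal_smul_mem_slab μ (hSC j) t y hr hc,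
        measureReal_smul_mem_slab μ (hSC 0) t y hr hc]
      rfl
  have hglue : Continuous (glue C t) := by
    refine continuous_pi fun i => ?_
    simp only [glue]
    split_ifs <;> fun_prop
  have hfun : Continuous fun y => lawCDF μ (A ∪ B ∪ C) (glue C t y) * lawCDF μ C (glue C t y) -
      lawCDF μ (A ∪ C) (glue C t y) * lawCDF μ (B ∪ C) (glue C t y) :=
    (((hcont _).comp hglue).mul ((hcont _).comp hglue)).sub
      (((hcont _).comp hglue).mul ((hcont _).comp hglue))
  -- The expression is continuous in `y` and vanishes almost everywhere, so it may be evaluated at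
  -- `y = t`, where gluing does nothing.
  have hfin := h.eq_zero_of_ae hfun hae ht
  have hgt : glue C t t = t := by ext i; simp [glue]
  simp only [hgt] at hfin
  exact sub_eq_zero.1 hfin

end Conditional

/-! ### From the random vector to its law -/

section Transfer

variable {Ω I : Type*} [MeasurableSpace Ω] {P : Measure Ω} {X : Ω → I → ℝ}

lemma IsSimpleMaxStable.isMaxStableLaw [Fintype I] (h : IsSimpleMaxStable P X) (hX : Measurable X) :
    IsMaxStableLaw (P.map X) := by
  intro n hn
  rw [h.maxStable n hn, Measure.map_map (by fun_prop) hX]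
  rfl

lemma measurable_subvector (hX : Measurable X) (A : Finset I) : Measurable (subvector X A) := by
  unfold subvector
  fun_prop

lemma marginalCDF_eq_lawCDF (hX : Measurable X) (A : Finset I) (x : I → ℝ) :
    marginalCDF P X A x = lawCDF (P.map X) A x := by
  rw [lawCDF, map_measureReal_apply hX (measurableSet_forall_le A x)]
  rfl

variable [IsProbabilityMeasure P]

lemma condExp_ae_eq_boundedCondProb (hX : Measurable X) (C S : Finset I) (t : I → ℝ) :
    P[(X ⁻¹' {z | ∀ i ∈ S, z i ≤ t i}).indicator (fun _ => (1 : ℝ)) |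
        MeasurableSpace.comap (subvector X C) inferInstance] =ᵐ[P]
      fun ω => boundedCondProb (P.map X) C S t (subvector X C ω) := by
  have hm := measurableSet_forall_le S t
  have h1 := condExp_indicator_ae_eq_rnDeriv P (measurable_subvector hX C) (hX hm)
  refine h1.trans (Eventually.of_forall fun ω => ?_)
  have e1 : boundedLaw (P.map X) C S t =
      (P.restrict (X ⁻¹' {z | ∀ i ∈ S, z i ≤ t i})).map (subvector X C) := by
    rw [boundedLaw, Measure.restrict_map hX hm, Measure.map_map (by fun_prop) hX]
    rfl
  have e2 : boundedLaw (P.map X) C ∅ t = P.map (subvector X C) := by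
    rw [boundedLaw_empty, Measure.map_map (by fun_prop) hX]
    rfl
  simp only [boundedCondProb, e1, e2]

/-- Conditional independence is tested on lower orthants only, and the almost sure identity is
pushed forward to the law of `X_C`. -/
lemma CondIndepGiven.ae_boundedCondProb_mul [DecidableEq I] (hX : Measurable X) {A B C : Finset I}
    (h : CondIndepGiven P (subvector X A) (subvector X B) (subvector X C)) (t : I → ℝ) :
    ∀ᵐ w ∂(boundedLaw (P.map X) C ∅ t), boundedCondProb (P.map X) C (A ∪ B) t w =
      boundedCondProb (P.map X) C A t w * boundedCondProb (P.map X) C B t w := by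
  have hpre : ∀ S : Finset I, subvector X S ⁻¹' {z : S → ℝ | ∀ i : S, z i ≤ t i} =
      X ⁻¹' {z | ∀ i ∈ S, z i ≤ t i} := fun S => by ext; simp [subvector]
  have hAB : X ⁻¹' {z | ∀ i ∈ A, z i ≤ t i} ∩ X ⁻¹' {z | ∀ i ∈ B, z i ≤ t i} =
      X ⁻¹' {z | ∀ i ∈ A ∪ B, z i ≤ t i} := by
    ext
    simp only [mem_inter_iff, mem_preimage, mem_ofPred_eq, Finset.mem_union, or_imp, forall_and]
  have h1 := h _ _ (measurableSet_forall_subtype_le A t) (measurableSet_forall_subtype_le B t)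
  rw [hpre, hpre, hAB] at h1
  have h2 : ∀ᵐ ω ∂P, boundedCondProb (P.map X) C (A ∪ B) t (subvector X C ω) =
      boundedCondProb (P.map X) C A t (subvector X C ω) *
        boundedCondProb (P.map X) C B t (subvector X C ω) := by
    filter_upwards [h1, condExp_ae_eq_boundedCondProb (P := P) hX C (A ∪ B) t,
      condExp_ae_eq_boundedCondProb (P := P) hX C A t,
      condExp_ae_eq_boundedCondProb (P := P) hX C B t] with ω e e1 e2 e3
    rw [← e1, ← e2, ← e3, e, Pi.mul_apply]
  have e2 : boundedLaw (P.map X) C ∅ t = P.map (subvector X C) := by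
    rw [boundedLaw_empty, Measure.map_map (by fun_prop) hX]
    rfl
  rw [e2]
  refine (ae_map_iff (measurable_subvector hX C).aemeasurable ?_).2 h2
  exact measurableSet_eq_fun (measurable_boundedCondProb _ _ _ _)
    ((measurable_boundedCondProb _ _ _ _).mul (measurable_boundedCondProb _ _ _ _))

end Transfer

/-! ### Independence from factorising distribution functions -/

section Independence

lemma isPiSystem_forall_le {Ω I : Type*} (X : Ω → I → ℝ) (A : Finset I) :
    IsPiSystem {s : Set Ω | ∃ x : I → ℝ, s = {ω | ∀ i ∈ A, X ω i ≤ x i}} := by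
  rintro _ ⟨x, rfl⟩ _ ⟨y, rfl⟩ -
  refine ⟨fun i => min (x i) (y i), ?_⟩
  ext ω
  simp only [mem_inter_iff, mem_ofPred_eq, le_min_iff, forall_and]

lemma comap_subvector_eq_generateFrom {Ω I : Type*} (X : Ω → I → ℝ) (A : Finset I) :
    MeasurableSpace.comap (subvector X A) inferInstance =
      MeasurableSpace.generateFrom {s | ∃ x : I → ℝ, s = {ω | ∀ i ∈ A, X ω i ≤ x i}} := by
  have hspan : IsCountablySpanning (range (Iic : ℝ → Set ℝ)) := by
    refine ⟨fun n => Iic (n : ℝ), fun n => mem_range_self _, ?_⟩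
    rw [eq_univ_iff_forall]
    exact fun x => mem_iUnion.2 (exists_nat_ge x)
  have hpi : (MeasurableSpace.pi : MeasurableSpace (A → ℝ)) =
      MeasurableSpace.generateFrom (univ.pi '' univ.pi fun _ : A => range (Iic : ℝ → Set ℝ)) := by
    rw [← generateFrom_pi_eq fun _ => hspan]
    congr 1
    funext _
    rw [← borel_eq_generateFrom_Iic]
    exact BorelSpace.measurable_eq
  rw [hpi, MeasurableSpace.comap_generateFrom]
  congr 1
  ext s
  constructor
  · rintro ⟨_, ⟨u, hu, rfl⟩, rfl⟩
    have hu' : ∀ i : A, ∃ c : ℝ, Iic c = u i := fun i => hu i (mem_univ i)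
    choose c hc using hu'
    classical
    refine ⟨fun i => if hi : i ∈ A then c ⟨i, hi⟩ else 0, ?_⟩
    ext ω
    simp only [mem_preimage, Set.mem_pi, mem_univ, forall_true_left, ← hc, mem_Iic, subvector,
      mem_ofPred_eq, Subtype.forall]
    exact forall_congr' fun i => forall_congr' fun hi => by simp [hi]
  · rintro ⟨x, rfl⟩
    refine ⟨univ.pi fun i : A => Iic (x i), ⟨_, fun i _ => mem_range_self _, rfl⟩, ?_⟩
    ext ω
    simp [subvector, Pi.le_def]

/-- Positive subvectors are independent as soon as their joint distribution function factorises on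
the orthant. -/
lemma indepFun_subvector_of_marginalCDF {Ω I : Type*} [MeasurableSpace Ω] [DecidableEq I]
    {P : Measure Ω} [IsProbabilityMeasure P] {X : Ω → I → ℝ} (hX : Measurable X)
    (hpos : ∀ᵐ ω ∂P, X ω ∈ posOrthant I) {A B : Finset I} (hAB : Disjoint A B)
    (h : ∀ x ∈ posOrthant I,
      marginalCDF P X (A ∪ B) x = marginalCDF P X A x * marginalCDF P X B x) :
    IndepFun (subvector X A) (subvector X B) P := by
  have hinter : ∀ x y : I → ℝ, {ω | ∀ i ∈ A, X ω i ≤ x i} ∩ {ω | ∀ i ∈ B, X ω i ≤ y i} =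
      {ω | ∀ i ∈ A ∪ B, X ω i ≤ if i ∈ A then x i else y i} := by
    intro x y
    ext ω
    simp only [mem_inter_iff, mem_ofPred_eq, Finset.mem_union, or_imp, forall_and]
    refine and_congr (forall_congr' fun i => forall_congr' fun hi => by simp [hi])
      (forall_congr' fun i => forall_congr' fun hi => ?_)
    simp [Finset.disjoint_right.1 hAB hi]
  have hnull : ∀ (T : Finset I) (x : I → ℝ) (i : I), i ∈ T → x i ≤ 0 →
      P {ω | ∀ i ∈ T, X ω i ≤ x i} = 0 := by
    intro T x i hi hxi
    refine measure_mono_null ?_ (ae_iff.1 hpos)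
    intro ω hω hcon
    exact absurd (hcon i) ((hω i hi).trans hxi).not_gt
  rw [IndepFun_iff_Indep]
  refine IndepSets.indep (measurable_subvector hX A).comap_le (measurable_subvector hX B).comap_le
    (isPiSystem_forall_le X A) (isPiSystem_forall_le X B) (comap_subvector_eq_generateFrom X A)
    (comap_subvector_eq_generateFrom X B) ?_
  rw [IndepSets_iff]
  rintro _ _ ⟨x, rfl⟩ ⟨y, rfl⟩
  -- The hypothesis covers positive bounds only; a nonpositive bound makes both sides vanish because
  -- `X` is almost surely positive.
  by_cases hx : ∃ i ∈ A, x i ≤ 0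
  · obtain ⟨i, hi, hxi⟩ := hx
    rw [measure_mono_null inter_subset_left (hnull A x i hi hxi), hnull A x i hi hxi, zero_mul]
  by_cases hy : ∃ i ∈ B, y i ≤ 0
  · obtain ⟨i, hi, hyi⟩ := hy
    rw [measure_mono_null inter_subset_right (hnull B y i hi hyi), hnull B y i hi hyi, mul_zero]
  push Not at hx hy
  set z : I → ℝ := fun i => if i ∈ A then x i else if i ∈ B then y i else 1
  have hz : z ∈ posOrthant I := fun i => by
    simp only [z]
    split_ifs with h1 h2
    exacts [hx i h1, hy i h2, one_pos]
  have eA : {ω | ∀ i ∈ A, X ω i ≤ x i} = {ω | ∀ i ∈ A, X ω i ≤ z i} := by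
    ext ω
    exact forall_congr' fun i => forall_congr' fun hi => by simp [z, hi]
  have eB : {ω | ∀ i ∈ B, X ω i ≤ y i} = {ω | ∀ i ∈ B, X ω i ≤ z i} := by
    ext ω
    exact forall_congr' fun i => forall_congr' fun hi => by
      simp [z, hi, Finset.disjoint_right.1 hAB hi]
  have h1 := h z hz
  simp only [marginalCDF, measureReal_def, ← ENNReal.toReal_mul] at h1
  rw [ENNReal.toReal_eq_toReal_iff' (by finiteness) (by finiteness)] at h1
  rw [eA, eB, hinter, ← h1]
  simp only [ite_self]

end Independence

end MaxStable

/-! ### The two assertions, after taking logarithms -/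

theorem proposition1 {Ω I : Type*} [MeasurableSpace Ω] [Fintype I] [DecidableEq I]
    (P : Measure Ω) [IsProbabilityMeasure P] (X : Ω → I → ℝ) (hX : Measurable X)
    (hmax : MaxStable.IsSimpleMaxStable P X)
    (hdens : MaxStable.HasPositiveContinuousDensity P X)
    (A B : Finset I) (hA : A.Nonempty) (hB : B.Nonempty) (hAB : Disjoint A B) :
    (MaxStable.CondIndepGiven P (MaxStable.subvector X A) (MaxStable.subvector X B)
        (MaxStable.subvector X (A ∪ B)ᶜ) →
      ∀ x ∈ MaxStable.posOrthant I, MaxStable.dPair P X A B x = 0) ∧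
    (IndepFun (MaxStable.subvector X A) (MaxStable.subvector X B) P ↔
      ∀ x ∈ MaxStable.posOrthant I, MaxStable.chiPair P X A B x = 0) := by
  have hprob : IsProbabilityMeasure (P.map X) := Measure.isProbabilityMeasure_map hX.aemeasurable
  have hlaw : MaxStable.IsPositiveDensityLaw (P.map X) := hdens
  have hpos : ∀ (T : Finset I), ∀ x ∈ MaxStable.posOrthant I,
      0 < MaxStable.marginalCDF P X T x := fun T x hx => by
    rw [MaxStable.marginalCDF_eq_lawCDF hX]
    exact MaxStable.lawCDF_pos hlaw T hx
  have hchi : ∀ x ∈ MaxStable.posOrthant I, (MaxStable.chiPair P X A B x = 0 ↔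
      MaxStable.marginalCDF P X (A ∪ B) x =
        MaxStable.marginalCDF P X A x * MaxStable.marginalCDF P X B x) := by
    intro x hx
    have h1 := hpos A x hx
    have h2 := hpos B x hx
    have h3 := hpos (A ∪ B) x hx
    rw [← Real.log_injOn_pos.eq_iff h3 (mul_pos h1 h2), Real.log_mul h1.ne' h2.ne']
    simp only [MaxStable.chiPair, MaxStable.exponentFun]
    constructor <;> intro h <;> linarith
  refine ⟨fun hcond x hx => ?_, fun hind x hx => (hchi x hx).2 ?_, fun h => ?_⟩
  · have hd1 : Disjoint A (A ∪ B)ᶜ :=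
      disjoint_compl_right.mono_left Finset.subset_union_left
    have hd2 : Disjoint B (A ∪ B)ᶜ :=
      disjoint_compl_right.mono_left Finset.subset_union_right
    have key := (hmax.isMaxStableLaw hX).lawCDF_mul_eq hlaw A B (A ∪ B)ᶜ hd1 hd2
      (hcond.ae_boundedCondProb_mul hX) hx
    simp only [← MaxStable.marginalCDF_eq_lawCDF hX, Finset.union_compl] at key
    have hlog := congrArg Real.log key
    rw [Real.log_mul (hpos _ x hx).ne' (hpos _ x hx).ne',
      Real.log_mul (hpos _ x hx).ne' (hpos _ x hx).ne'] at hlog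
    simp only [MaxStable.dPair, MaxStable.exponentFun]
    linarith
  · have hm := fun S : Finset I => MaxStable.measurableSet_forall_subtype_le S x
    have h1 := hind.measure_inter_preimage_eq_mul _ _ (hm A) (hm B)
    have hpre : ∀ S : Finset I, MaxStable.subvector X S ⁻¹' {z : S → ℝ | ∀ i : S, z i ≤ x i} =
        {ω | ∀ i ∈ S, X ω i ≤ x i} := fun S => by ext; simp [MaxStable.subvector]
    have hinter : {ω | ∀ i ∈ A, X ω i ≤ x i} ∩ {ω | ∀ i ∈ B, X ω i ≤ x i} =
        {ω | ∀ i ∈ A ∪ B, X ω i ≤ x i} := by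
      ext
      simp only [Set.mem_inter_iff, Set.mem_ofPred_eq, Finset.mem_union, or_imp, forall_and]
    rw [hpre, hpre, hinter] at h1
    simp only [MaxStable.marginalCDF, measureReal_def, h1, ENNReal.toReal_mul]
  · refine MaxStable.indepFun_subvector_of_marginalCDF hX ?_ hAB fun x hx => (hchi x hx).1 (h x hx)
    refine ae_of_ae_map hX.aemeasurable ?_
    exact hlaw.absolutelyContinuous.ae_le
      (ae_restrict_mem MaxStable.isOpen_posOrthant.measurableSet)
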